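/- Let $\mathcal N=(\mathcal P_v)_{v\in V}$ be a finite abelian network on a directed graph $G=(V,E)$, with total alphabet $A=\bigsqcup_{v\in V}A_v$ and state space $Q=\prod_{v\in V}Q_v$ (with $V$ and all $A_v$, $Q_v$ finite). That is, each $\mathcal P_v$ has commuting transition maps $t_a:Q_v\to Q_v$ ($a\in A_v$), and when it processes the letter $a$ in state $q_v$ it moves to $t_a(q_v)$ and sends a word $o_a^u(q_v)\in A_u^*$ to each out-neighbor $u$ of $v$; if two input words are equal up to permutation, then, from any initial state, so are the resulting output words along each edge. For $\mathbf x\in\mathbb Z^A$ and $\mathbf q\in Q$ let $\mathbf x.\mathbf q$ denote the network with internal states $\mathbf q$ and $\mathbf x_a$ letters $a$ waiting to be processed, for each $a \in A$. Processing a letter $a$ decreases its count by one, changes the state of its processor, and adds the letters sent. A finite sequence of letters is a legal execution if each letter is present (has count at least $1$) when it is processed, and a complete one if no letters remain at the end (all counts are $\le 0$). Assume that $\mathcal N$ halts on all inputs: for all $\mathbf x\in\mathbb N^A$ and $\mathbf q\in Q$ there is a complete legal execution for $\mathbf x.\mathbf q$. Its final state does not depend on the execution and is denoted $\mathbf x\triangleright\!\triangleright\mathbf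 q$. The minimal idempotent of a finite commutative monoid $M$ is the unique idempotent $e\in M$ with $e\in Mm$ for all $m\in M$. Let $e_v$ be the minimal idempotent of the local monoid $M_v=\langle t_a\rangle_{a\in A_v}$ of self-maps of $Q_v$, and let $e$ be that of the global monoid $M$, generated by the maps $\mathbf q\mapsto \mathbf 1_a\triangleright\!\triangleright\mathbf q$ ($a\in A$) of $Q$ to itself. A state $\mathbf q$ is recurrent if $e\mathbf q=\mathbf q$, and locally recurrent if $e_v\mathbf q_v=\mathbf q_v$ for all $v\in V$. Assume that $\mathcal N$ is irreducible: for all $v \in V$ and $q,q'\in Q_v$ there are $m,m'\in M_v$ with $mq=m'q'$. Each $t_a$, $a\in A_v$, permutes $e_vQ_v$, so $\mathbb Z^{A_v}$ acts on $e_vQ_v$; let $K_v$ be the kernel of this action, and let $K=\prod_{v}K_v\subset\mathbb Z^A$ be the total kernel. Let $P:K\to\mathbb Z^A$ be the production map: the group homomorphism such that, for $\mathbf k\in K\cap\mathbb N^A$, $P\mathbf k$ counts the letters sent when $\mathbf k_a$ letters $a$ are processed for each $a\in A$, starting from a locally recurrent state $\mathbf r$ (to which the processors then return). It does not depend on the choice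 of $\mathbf r$. Let $\mathbf k\in K$ be such that $\mathbf k\ge\mathbf 1$ and $P\mathbf k\le\mathbf k$ (coordinatewise). Then $\mathbf q\in Q$ is recurrent if and only if $(I-P)\mathbf k\triangleright\!\triangleright\mathbf q=\mathbf q$. -/

import Mathlib

/-! ### Monoids of self-maps -/

/-- The defining action of a monoid `M` of self-maps of `X` is irreducible: any two points have
a common image. -/
def IsIrreducibleAction {X : Type*} (M : Submonoid (Function.End X)) : Prop :=
  ∀ x x' : X, ∃ m ∈ M, ∃ m' ∈ M, m x = m' x'

/-- `e` is the minimal idempotent of `M`: the idempotent of `M` accessible from all of `M`. It is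
unique if `M` is commutative, and exists if moreover `M` is finite. -/
def IsMinimalIdempotent {X : Type*} (M : Submonoid (Function.End X)) (e : Function.End X) : Prop :=
  e ∈ M ∧ e * e = e ∧ ∀ m ∈ M, ∃ m' ∈ M, e = m' * m

/-- `x` is recurrent for the action of `M`: it is fixed by the minimal idempotent of `M`. -/
def IsRecurrentFor {X : Type*} (M : Submonoid (Function.End X)) (x : X) : Prop :=
  ∃ e, IsMinimalIdempotent M e ∧ e x = x

/-! ### Abelian processors -/

/-- The word sent along one output feed when the input word is processed letter by letter,
from left to right. -/
def outputWord {I Q B : Type*} (t : I → Function.End Q) (o : I → Q → List B) :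
    List I → Q → List B
  | [], _ => []
  | a :: w, q => o a q ++ outputWord t o w (t a q)

/-- An abelian processor with input alphabet `I`, output alphabets `B u` and state space `Q`. -/
structure AbelianProcessor (I : Type*) {U : Type*} (B : U → Type*) (Q : Type*) where
  /-- the state transitions -/
  t : I → Function.End Q
  /-- the message passing functions -/
  o : I → (u : U) → Q → List (B u)
  t_comm : ∀ a b, t a * t b = t b * t a
  o_perm : ∀ w w' : List I, w.Perm w' → ∀ (u : U) (q : Q),
    (outputWord t (fun a => o a u) w q).Perm (outputWord t (fun a => o a u) w' q)

namespace AbelianProcessor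

variable {I U Q : Type*} {B : U → Type*} (p : AbelianProcessor I B Q)

/-- The transition monoid of a processor. -/
def monoid : Submonoid (Function.End Q) := Submonoid.closure (Set.range p.t)

theorem mul_comm_of_mem {m m' : Function.End Q} (hm : m ∈ p.monoid) (hm' : m' ∈ p.monoid) :
    m * m' = m' * m := by
  have := Submonoid.isMulCommutative_closure (Function.End Q) (s := Set.range p.t) (by
    rintro _ ⟨a, rfl⟩ _ ⟨b, rfl⟩
    exact p.t_comm a b)
  exact congrArg Subtype.val (this.is_comm.comm ⟨m, hm⟩ ⟨m', hm'⟩)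

theorem pow_commute (x y : I → ℕ) (a b : I) : Commute (p.t a ^ x a) (p.t b ^ y b) :=
  Commute.pow_pow (p.t_comm a b) _ _

/-- The map `t(x) = ∏ₐ tₐ ^ xₐ`, for `x ∈ ℕ^I`. -/
def trans [Fintype I] (x : I → ℕ) : Function.End Q :=
  Finset.univ.noncommProd (fun a => p.t a ^ x a) fun a _ b _ _ => p.pow_commute x x a b

theorem trans_mem [Fintype I] (x : I → ℕ) : p.trans x ∈ p.monoid :=
  Submonoid.noncommProd_mem _ _ _ _ fun a _ =>
    pow_mem (Submonoid.subset_closure (Set.mem_range_self a)) _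

theorem trans_add [Fintype I] (x y : I → ℕ) : p.trans (x + y) = p.trans x * p.trans y := by
  refine Eq.trans ?_ (Finset.noncommProd_mul_distrib (fun a => p.t a ^ x a)
    (fun a => p.t a ^ y a) _ _ fun a _ b _ _ => p.pow_commute y x a b)
  exact Finset.noncommProd_congr rfl (fun a _ => pow_add (p.t a) (x a) (y a)) _

theorem trans_zero [Fintype I] : p.trans 0 = 1 :=
  (Finset.noncommProd_eq_pow_card _ _ _ 1 fun a _ => pow_zero (p.t a)).trans (one_pow _)

theorem trans_single [Fintype I] [DecidableEq I] (a : I) :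
    p.trans (Pi.single a 1) = p.t a := by
  refine (Finset.mul_noncommProd_erase Finset.univ (Finset.mem_univ a) _ _).symm.trans ?_
  refine (congrArg (p.t a ^ (Pi.single a 1 : I → ℕ) a * ·)
    (Finset.noncommProd_eq_pow_card _ _ _ 1 fun b hb => ?_)).trans ?_
  · simp [Pi.single_eq_of_ne (Finset.ne_of_mem_erase hb)]
  · simp

theorem trans_apply_comm [Fintype I] (x y : I → ℕ) (q : Q) :
    p.trans x (p.trans y q) = p.trans y (p.trans x q) := by
  have h := congrFun ((p.trans_add x y).symm.trans ((congrArg p.trans (add_comm x y)).trans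
    (p.trans_add y x))) q
  exact h

/-- A transition map is injective on recurrent states. -/
theorem trans_injective [Fintype I] (x : I → ℕ) {q q' : Q} (hq : IsRecurrentFor p.monoid q)
    (hq' : IsRecurrentFor p.monoid q') (h : p.trans x q = p.trans x q') : q = q' := by
  obtain ⟨e, ⟨heM, hee, he⟩, heq⟩ := hq
  obtain ⟨f, ⟨hfM, hff, hf⟩, hfq⟩ := hq'
  obtain ⟨m, hm, rfl⟩ := he f hfM
  obtain ⟨m', hm', h2⟩ := hf (m * f) heM
  have hef : m * f = f := by
    calc m * f = (m * f) * f := by rw [mul_assoc, hff]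
      _ = f * (m * f) := p.mul_comm_of_mem heM hfM
      _ = (m' * (m * f)) * (m * f) := by rw [← h2]
      _ = m' * ((m * f) * (m * f)) := mul_assoc _ _ _
      _ = f := by rw [hee, ← h2]
  rw [hef] at heq
  obtain ⟨g, -, hg⟩ := hf _ (p.trans_mem x)
  calc q = g (p.trans x q) := heq.symm.trans (congrFun hg q)
    _ = g (p.trans x q') := by rw [h]
    _ = q' := (congrFun hg q').symm.trans hfq

theorem trans_recurrent [Fintype I] (x : I → ℕ) {q : Q} (hq : IsRecurrentFor p.monoid q) :
    IsRecurrentFor p.monoid (p.trans x q) := by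
  obtain ⟨e, he, heq⟩ := hq
  refine ⟨e, he, ?_⟩
  have h : e * p.trans x = p.trans x * e := p.mul_comm_of_mem he.1 (p.trans_mem x)
  calc e (p.trans x q) = p.trans x (e q) := congrFun h q
    _ = p.trans x q := by rw [heq]

end AbelianProcessor

/-- The positive part of an integer vector. -/
def posVec {ι : Type*} (z : ι → ℤ) : ι → ℕ := fun a => (z a).toNat

theorem posVec_zero {ι : Type*} : posVec (0 : ι → ℤ) = 0 := rfl

theorem posVec_add {ι : Type*} (z w : ι → ℤ) :
    posVec (z + w) + (posVec (-z) + posVec (-w)) =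
      (posVec z + posVec w) + posVec (-(z + w)) := by
  funext a
  simp only [posVec, Pi.add_apply, Pi.neg_apply]
  omega

namespace AbelianProcessor

variable {I U Q : Type*} {B : U → Type*} (p : AbelianProcessor I B Q)

/-- The kernel of the action of `ℤ^I` on the recurrent states of the processor. The vector `z`
acts by `t(z⁺) t(z⁻)⁻¹`, where `z⁺` and `z⁻` are the positive and negative parts of `z`. -/
def kernel [Fintype I] : AddSubgroup (I → ℤ) where
  carrier := {z | ∀ q, IsRecurrentFor p.monoid q →
    p.trans (posVec z) q = p.trans (posVec (-z)) q}
  zero_mem' := by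
    intro q _
    rw [neg_zero]
  neg_mem' := by
    intro z hz q hq
    rw [neg_neg]
    exact (hz q hq).symm
  add_mem' := by
    intro z w hz hw q hq
    have key : ∀ x y : I → ℕ, ∀ s, p.trans (x + y) s = p.trans x (p.trans y s) :=
      fun x y s => congrFun (p.trans_add x y) s
    refine p.trans_injective (posVec (-z) + posVec (-w)) (p.trans_recurrent _ hq)
      (p.trans_recurrent _ hq) ?_
    have h1 : p.trans (posVec z + posVec w) q = p.trans (posVec (-z) + posVec (-w)) q := by
      rw [key, hw q hq, key, hz _ (p.trans_recurrent _ hq)]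
    rw [← key, add_comm, posVec_add, add_comm, key, h1, p.trans_apply_comm]

end AbelianProcessor

/-! ### Abelian networks -/

/-- An abelian network on a directed graph `G` with alphabets `A v` and state spaces `Q v`:
the processor at `v` has one output feed for each out-neighbor of `v`. -/
structure AbelianNetwork {V : Type*} (G : Digraph V) (A Q : V → Type*) where
  proc : ∀ v, AbelianProcessor (A v) (fun u : {u : V // G.Adj v u} => A u.1) (Q v)

/-- The total alphabet, a disjoint union. -/
abbrev Letter {V : Type*} (A : V → Type*) := Σ v, A v

/-- A total state `x.q`: numbers of waiting letters (possibly negative) and internal states. -/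
abbrev TotalState {V : Type*} (A Q : V → Type*) := (Letter A → ℤ) × (∀ v, Q v)

/-- A word with exactly `x a` letters `a`, for each `a`. -/
noncomputable def wordOf {ι : Type*} [Fintype ι] (x : ι → ℕ) : List ι :=
  (∑ a, x a • ({a} : Multiset ι)).toList

theorem wordOf_add {ι : Type*} [Fintype ι] (x y : ι → ℕ) :
    (wordOf (x + y)).Perm (wordOf x ++ wordOf y) := by
  rw [← Multiset.coe_eq_coe, ← Multiset.coe_add]
  simp [wordOf, add_smul, Finset.sum_add_distrib]

theorem wordOf_count {ι : Type*} [Fintype ι] [DecidableEq ι] (x : ι → ℕ) (a : ι) :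
    (wordOf x).count a = x a := by
  rw [← Multiset.coe_count]
  simp [wordOf, Multiset.count_sum', Multiset.count_singleton]

namespace AbelianNetwork

variable {V : Type*} {G : Digraph V} {A Q : V → Type*} (N : AbelianNetwork G A Q)

open Classical in
/-- The number of letters `b` sent when the letter `a` is processed in state `q`. -/
noncomputable def message (a : Letter A) (q : ∀ v, Q v) (b : Letter A) : ℕ :=
  if h : G.Adj a.1 b.1 then ((N.proc a.1).o a.2 ⟨b.1, h⟩ (q a.1)).count b.2 else 0

open Classical in
/-- The new internal states after the letter `a` is processed in state `q`. -/
noncomputable def next (a : Letter A) (q : ∀ v, Q v) : ∀ v, Q v :=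
  Function.update q a.1 ((N.proc a.1).t a.2 (q a.1))

open Classical in
/-- Processing one letter `a`, whether or not such a letter is present. -/
noncomputable def process (a : Letter A) (s : TotalState A Q) : TotalState A Q :=
  (fun b => s.1 b - (if b = a then 1 else 0) + (N.message a s.2 b : ℤ), N.next a s.2)

/-- The result `π_w(x.q)` of executing the word `w`, from left to right. -/
noncomputable def exec (w : List (Letter A)) (s : TotalState A Q) : TotalState A Q :=
  w.foldl (fun s a => N.process a s) s

/-- An execution is legal if each letter is present when it is processed. -/
def IsLegal : List (Letter A) → TotalState A Q → Prop
  | [], _ => True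
  | a :: w, s => 1 ≤ s.1 a ∧ IsLegal w (N.process a s)

/-- An execution is complete if it leaves no letters. -/
def IsComplete (w : List (Letter A)) (s : TotalState A Q) : Prop := (N.exec w s).1 ≤ 0

/-- The network halts on every input `x.q` with `x ∈ ℕ^A`. -/
def HaltsOnAllInputs : Prop :=
  ∀ (x : Letter A → ℕ) (q : ∀ v, Q v), ∃ w,
    N.IsLegal w (fun a => (x a : ℤ), q) ∧ N.IsComplete w (fun a => (x a : ℤ), q)

/-- The global action `x ▷▷ q`: the final state of a complete legal execution for `x.q`. -/
noncomputable def globalAct (h : N.HaltsOnAllInputs) (x : Letter A → ℕ) (q : ∀ v, Q v) :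
    ∀ v, Q v :=
  (N.exec (h x q).choose (fun a => (x a : ℤ), q)).2

open Classical in
/-- The global monoid, generated by the maps `q ↦ 1ₐ ▷▷ q`. -/
noncomputable def globalMonoid (h : N.HaltsOnAllInputs) : Submonoid (Function.End (∀ v, Q v)) :=
  Submonoid.closure (Set.range fun (a : Letter A) (q : ∀ v, Q v) => N.globalAct h (Pi.single a 1) q)

/-- Recurrent states of the network. -/
def IsRecurrent (h : N.HaltsOnAllInputs) (q : ∀ v, Q v) : Prop :=
  IsRecurrentFor (N.globalMonoid h) q

/-- Every processor is irreducible. -/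
def IsIrreducible : Prop := ∀ v, IsIrreducibleAction (N.proc v).monoid

/-- Every processor is in a recurrent state. -/
def IsLocallyRecurrent (q : ∀ v, Q v) : Prop := ∀ v, IsRecurrentFor (N.proc v).monoid (q v)

/-- The total kernel, the product of the kernels of the processors. -/
def totalKernel [∀ v, Fintype (A v)] : AddSubgroup (Letter A → ℤ) where
  carrier := {z | ∀ v, (fun a => z ⟨v, a⟩) ∈ (N.proc v).kernel}
  zero_mem' := fun v => (N.proc v).kernel.zero_mem
  neg_mem' := fun hz v => (N.proc v).kernel.neg_mem (hz v)
  add_mem' := fun hz hw v => (N.proc v).kernel.add_mem (hz v) (hw v)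

/-- The local action `x ▷ s`: add `x` to the waiting letters, then execute `x`. -/
noncomputable def localAct [Fintype V] [∀ v, Fintype (A v)] (x : Letter A → ℕ)
    (s : TotalState A Q) : TotalState A Q :=
  N.exec (wordOf x) (fun a => (x a : ℤ) + s.1 a, s.2)

theorem next_comm (a b : Letter A) (q : ∀ v, Q v) :
    N.next b (N.next a q) = N.next a (N.next b q) := by
  classical
  obtain ⟨v, a⟩ := a
  obtain ⟨u, b⟩ := b
  by_cases h : v = u
  · subst h
    have := congrFun ((N.proc v).t_comm b a) (q v)
    simp only [next, Function.update_self, Function.update_idem]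
    exact congrArg (Function.update q v) this
  · simp only [next, Function.update_of_ne h, Function.update_of_ne (Ne.symm h)]
    exact (Function.update_comm h _ _ _)

theorem message_comm (a b : Letter A) (q : ∀ v, Q v) (c : Letter A) :
    N.message a q c + N.message b (N.next a q) c =
      N.message b q c + N.message a (N.next b q) c := by
  classical
  obtain ⟨v, a⟩ := a
  obtain ⟨u, b⟩ := b
  by_cases h : v = u
  · subst h
    by_cases hc : G.Adj v c.1
    · have := ((N.proc v).o_perm [a, b] [b, a] (List.Perm.swap b a []) ⟨c.1, hc⟩
        (q v)).count_eq c.2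
      simpa [message, next, hc, outputWord] using this
    · simp [message, hc]
  · simp [message, next, Function.update_of_ne h, Function.update_of_ne (Ne.symm h), add_comm]

theorem process_comm (a b : Letter A) (s : TotalState A Q) :
    N.process b (N.process a s) = N.process a (N.process b s) := by
  refine Prod.ext (funext fun c => ?_) (N.next_comm a b s.2)
  have := N.message_comm a b s.2 c
  simp only [process]
  push_cast [← @Nat.cast_inj ℤ] at this
  linarith

theorem exec_perm {w w' : List (Letter A)} (h : w.Perm w') (s : TotalState A Q) :
    N.exec w s = N.exec w' s := by
  have : RightCommutative (fun (s : TotalState A Q) (a : Letter A) => N.process a s) :=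
    ⟨fun s a b => N.process_comm a b s⟩
  exact h.foldl_eq s

theorem exec_shift (w : List (Letter A)) (s : TotalState A Q) (y : Letter A → ℤ) :
    N.exec w (s.1 + y, s.2) = ((N.exec w s).1 + y, (N.exec w s).2) := by
  induction w generalizing s with
  | nil => rfl
  | cons a w ih =>
    have h : N.process a (s.1 + y, s.2) = ((N.process a s).1 + y, (N.process a s).2) := by
      refine Prod.ext (funext fun c => ?_) rfl
      simp only [process, Pi.add_apply]
      ring
    change N.exec w (N.process a (s.1 + y, s.2)) = _
    rw [h, ih]
    rfl

open Classical in
theorem exec_snd [∀ v, Fintype (A v)] (w : List (Letter A)) (s : TotalState A Q) (v : V) :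
    (N.exec w s).2 v = (N.proc v).trans (fun a => w.count ⟨v, a⟩) (s.2 v) := by
  induction w generalizing s with
  | nil =>
    exact (congrFun (N.proc v).trans_zero (s.2 v)).symm
  | cons b w ih =>
    change (N.exec w (N.process b s)).2 v = _
    rw [ih]
    obtain ⟨u, b⟩ := b
    by_cases h : u = v
    · subst h
      have e : (fun a => (((⟨u, b⟩ : Letter A) :: w).count ⟨u, a⟩)) =
          (fun a => w.count (⟨u, a⟩ : Letter A)) + Pi.single b 1 := by
        funext a
        rw [List.count_cons]
        by_cases hab : a = b
        · subst hab; simp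
        · have : b ≠ a := fun h => hab h.symm
          simp [hab, this]
      rw [e, (N.proc u).trans_add, (N.proc u).trans_single]
      simp only [process, next, Function.update_self]
      rfl
    · have e : (fun a => (((⟨u, b⟩ : Letter A) :: w).count ⟨v, a⟩)) =
          (fun a => w.count (⟨v, a⟩ : Letter A)) := by
        funext a
        rw [List.count_cons]
        simp [h]
      rw [e]
      simp only [process, next, Function.update_of_ne (Ne.symm h)]

section Production

variable [Fintype V] [∀ v, Fintype (A v)]

theorem localAct_shift (x : Letter A → ℕ) (s : TotalState A Q) (y : Letter A → ℤ) :
    N.localAct x (s.1 + y, s.2) = ((N.localAct x s).1 + y, (N.localAct x s).2) := by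
  unfold localAct
  rw [← N.exec_shift (wordOf x) (fun a => (x a : ℤ) + s.1 a, s.2) y]
  refine congrArg (N.exec (wordOf x)) (Prod.ext (funext fun c => ?_) rfl)
  simp only [Pi.add_apply]
  ring

theorem localAct_add (x y : Letter A → ℕ) (s : TotalState A Q) :
    N.localAct (x + y) s = N.localAct y (N.localAct x s) := by
  have h : ((fun a => (((x + y) a : ℕ) : ℤ) + s.1 a, s.2) : TotalState A Q) =
      ((fun a => (x a : ℤ) + s.1 a) + (fun a => (y a : ℤ)), s.2) := by
    refine Prod.ext (funext fun c => ?_) rfl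
    simp only [Pi.add_apply, Nat.cast_add]
    ring
  have h2 := N.exec_shift (wordOf x) (fun a => (x a : ℤ) + s.1 a, s.2) (fun a => (y a : ℤ))
  unfold localAct
  rw [N.exec_perm (wordOf_add x y), h]
  unfold exec at h2 ⊢
  rw [List.foldl_append, h2]
  refine congrArg (fun s => List.foldl _ s (wordOf y)) (Prod.ext (funext fun c => ?_) rfl)
  exact add_comm _ _

theorem localAct_snd (x : Letter A → ℕ) (s : TotalState A Q) (v : V) :
    (N.localAct x s).2 v = (N.proc v).trans (fun a => x ⟨v, a⟩) (s.2 v) := by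
  classical
  unfold localAct
  rw [exec_snd]
  simp only [wordOf_count]

/-- The letters sent when `x` is processed in state `q`: the vector `y` with `x ▷ q = y.r`. -/
noncomputable def sent (x : Letter A → ℕ) (q : ∀ v, Q v) : Letter A → ℤ := (N.localAct x (0, q)).1

theorem sent_add (x y : Letter A → ℕ) (q : ∀ v, Q v) :
    N.sent (x + y) q = N.sent x q + N.sent y (N.localAct x (0, q)).2 := by
  have h := N.localAct_shift y (0, (N.localAct x (0, q)).2) (N.localAct x (0, q)).1
  rw [zero_add] at h
  unfold sent
  rw [localAct_add]
  exact (congrArg Prod.fst h).trans (add_comm _ _)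

theorem sent_diff_add {x y x' y' : Letter A → ℕ} {q : ∀ v, Q v}
    (h : (N.localAct x (0, q)).2 = (N.localAct y (0, q)).2)
    (h' : (N.localAct x' (0, q)).2 = (N.localAct y' (0, q)).2) :
    N.sent (x + x') q - N.sent (y + y') q =
      (N.sent x q - N.sent y q) + (N.sent x' q - N.sent y' q) := by
  have h1 := N.sent_add x x' q
  have h2 := N.sent_add x' x q
  have h3 := N.sent_add x y' q
  have h4 := N.sent_add y' x q
  have h5 := N.sent_add y y' q
  rw [add_comm x' x, h'] at h2
  rw [add_comm y' x] at h4
  rw [← h] at h5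
  rw [h5, h2, eq_sub_of_add_eq' (h3.symm.trans h4)]
  abel

theorem localAct_posVec_of_mem {z : Letter A → ℤ} (hz : z ∈ N.totalKernel) {r : ∀ v, Q v}
    (hr : N.IsLocallyRecurrent r) :
    (N.localAct (posVec z) (0, r)).2 = (N.localAct (posVec (-z)) (0, r)).2 := by
  funext v
  rw [localAct_snd, localAct_snd]
  exact hz v (r v) (hr v)

/-- The production map `P_r : K → ℤ^A` at a locally recurrent state `r`: the homomorphism with
`k ▷ r = P_r(k).r` for all nonnegative `k ∈ K` (`localAct_eq_production`). For `k ∈ K` of mixed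
sign the vectors `k⁺` and `k⁻` lead from `r` to the same state, and `P_r(k)` is the difference
of the letters sent. -/
noncomputable def production (r : ∀ v, Q v) (hr : N.IsLocallyRecurrent r) :
    N.totalKernel →+ (Letter A → ℤ) where
  toFun k := N.sent (posVec k.1) r - N.sent (posVec (-k.1)) r
  map_zero' := by simp
  map_add' := by
    intro z w
    have hz := N.localAct_posVec_of_mem z.2 hr
    have hw := N.localAct_posVec_of_mem w.2 hr
    have hs := N.localAct_posVec_of_mem (z + w).2 hr
    have hzw : (N.localAct (posVec z.1 + posVec w.1) (0, r)).2 =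
        (N.localAct (posVec (-z.1) + posVec (-w.1)) (0, r)).2 := by
      have key : ∀ x y : Letter A → ℕ, (N.localAct (x + y) (0, r)).2 =
          (N.localAct y (0, (N.localAct x (0, r)).2)).2 := by
        intro x y
        funext v
        rw [localAct_add, localAct_snd, localAct_snd, localAct_snd, localAct_snd]
      rw [key, hz, ← key, add_comm, key, hw, ← key, add_comm]
    have h1 := N.sent_diff_add hs
      (rfl : (N.localAct (posVec (-z.1) + posVec (-w.1)) (0, r)).2 = _)
    have h2 := N.sent_diff_add hzw
      (rfl : (N.localAct (posVec (-(z.1 + w.1))) (0, r)).2 = _)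
    rw [AddSubgroup.coe_add, posVec_add] at h1
    rw [sub_self, add_zero] at h1 h2
    rw [AddSubgroup.coe_add, ← N.sent_diff_add hz hw, ← h2, ← h1, add_comm (posVec (-z.1) + _)]

theorem localAct_eq_production (r : ∀ v, Q v) (hr : N.IsLocallyRecurrent r) (k : N.totalKernel)
    (hk : 0 ≤ k.1) : N.localAct (posVec k.1) (0, r) = (N.production r hr k, r) := by
  have h0 : posVec (-k.1) = 0 := by
    funext a
    have := hk a
    simp only [posVec, Pi.neg_apply, Pi.zero_apply] at this ⊢
    omega
  have h1 : N.localAct 0 (0, r) = (0, r) := by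
    simp only [localAct, wordOf, Pi.zero_apply, zero_smul, Finset.sum_const_zero,
      Multiset.toList_zero]
    exact Prod.ext (funext fun c => by simp [exec]) rfl
  refine Prod.ext ?_ ?_
  · change _ = N.sent (posVec k.1) r - N.sent (posVec (-k.1)) r
    rw [h0]
    unfold sent
    rw [h1, sub_zero]
  · rw [N.localAct_posVec_of_mem k.2 hr, h0, h1]

end Production

end AbelianNetwork

/-!
By the least action principle, a legal execution uses each letter at most as often as any complete
execution does, so that final states do not depend on the order of processing.

If `q` is recurrent, then it is locally recurrent, so processing `k` in `k.q` gives `Pk.q`.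
Hence `k ▷▷ q = Pk ▷▷ q`, and `k = Pk + x` with `x = (I - P)k`. Cancelling `Pk`, which permutes the
recurrent states, leaves `x ▷▷ q = q`.

Conversely, suppose that `x ▷▷ q = q`, and choose `n > 0` such that `nx` acts as an idempotent. Let
`s` be a state fixed by `nx`, for example `q`, and let `u` count the letters processed in `nx.s`.
Then `(I - P)u = nx ≥ x = (I - P)k`. As the network halts, no nonzero vector `c ≥ 0` satisfies
`Pc ≥ c`, which makes `I - P` inverse-positive and gives `u ≥ k ≥ 1`. So every letter `a` occurs in
the execution, and by holding back one of them until the end we get `s = 1ₐ ▷▷ s'` for some `s'`,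
which may be replaced by `nx ▷▷ s'`. Hence every generator of the global monoid maps the set of
states fixed by `nx` onto itself, and so does its minimal idempotent, which therefore fixes `q`.
-/

theorem exists_isIdempotentElem_pow {M : Type*} [Monoid M] [Finite M] (m : M) :
    ∃ n, 0 < n ∧ IsIdempotentElem (m ^ n) := by
  let _ : TopologicalSpace M := ⊥
  have : DiscreteTopology M := ⟨rfl⟩
  obtain ⟨_, ⟨n, rfl⟩, hn⟩ := exists_idempotent_in_compact_subsemigroup
    (fun _ => continuous_of_discreteTopology) (Set.range fun n => m ^ (n + 1))
    (Set.range_nonempty _) (Set.toFinite _).isCompact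
    (by rintro _ ⟨i, rfl⟩ _ ⟨j, rfl⟩; exact ⟨i + 1 + j, pow_add m (i + 1) (j + 1)⟩)
  exact ⟨n + 1, n.succ_pos, hn⟩

theorem exists_isIdempotentElem_forall_dvd (M : Type*) [CommMonoid M] [Finite M] :
    ∃ e : M, IsIdempotentElem e ∧ ∀ m, m ∣ e := by
  have := Fintype.ofFinite M
  obtain ⟨n, hn, he⟩ := exists_isIdempotentElem_pow (∏ m : M, m)
  exact ⟨_, he, fun m => (Finset.dvd_prod_of_mem id (Finset.mem_univ m)).trans
    (dvd_pow_self _ hn.ne')⟩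

theorem posVec_add_posVec_sub {ι : Type*} {y z : ι → ℤ} (hy : 0 ≤ y) (hyz : y ≤ z) :
    posVec y + posVec (z - y) = posVec z := by
  funext a
  have hya : 0 ≤ y a := hy a
  have hyza : y a ≤ z a := hyz a
  simp only [posVec, Pi.add_apply, Pi.sub_apply]
  omega

section CommutativeAction

variable {X : Type*} {M : Submonoid (Function.End X)} [IsMulCommutative M]

theorem mul_comm_of_mem_submonoid {m m' : Function.End X} (hm : m ∈ M) (hm' : m' ∈ M) :
    m * m' = m' * m :=
  congrArg Subtype.val (mul_comm' (⟨m, hm⟩ : M) ⟨m', hm'⟩)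

open scoped IsMulCommutative in
variable (M) in
theorem exists_isMinimalIdempotent [Finite M] : ∃ e, IsMinimalIdempotent M e := by
  obtain ⟨e, he, hdvd⟩ := exists_isIdempotentElem_forall_dvd M
  refine ⟨e, e.2, congrArg Subtype.val he, fun m hm => ?_⟩
  obtain ⟨m', hm'⟩ := hdvd ⟨m, hm⟩
  exact ⟨m', m'.2, congrArg Subtype.val (hm'.trans (mul_comm _ m'))⟩

theorem IsMinimalIdempotent.unique {e f : Function.End X} (he : IsMinimalIdempotent M e)
    (hf : IsMinimalIdempotent M f) : e = f := by
  have absorb {e f : Function.End X} (he : IsMinimalIdempotent M e)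
      (hf : IsMinimalIdempotent M f) : e * f = e := by
    obtain ⟨m, -, hm⟩ := he.2.2 f hf.1
    rw [hm, mul_assoc, hf.2.1]
  rw [← absorb he hf, mul_comm_of_mem_submonoid he.1 hf.1, absorb hf he]

namespace IsRecurrentFor

variable {m : Function.End X} {x y : X}

theorem apply (hx : IsRecurrentFor M x) (hm : m ∈ M) : IsRecurrentFor M (m x) := by
  obtain ⟨e, he, hex⟩ := hx
  refine ⟨e, he, ?_⟩
  calc e (m x) = m (e x) := congrFun (mul_comm_of_mem_submonoid he.1 hm) x
    _ = m x := by rw [hex]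

theorem exists_apply_eq (hx : IsRecurrentFor M x) (hm : m ∈ M) : ∃ y, m y = x := by
  obtain ⟨e, he, hex⟩ := hx
  obtain ⟨m', hm', rfl⟩ := he.2.2 m hm
  refine ⟨m' x, ?_⟩
  calc m (m' x) = m' (m x) := congrFun (mul_comm_of_mem_submonoid hm hm') x
    _ = x := hex

theorem eq_of_apply_eq (hx : IsRecurrentFor M x) (hy : IsRecurrentFor M y) (hm : m ∈ M)
    (hxy : m x = m y) : x = y := by
  obtain ⟨e, he, hex⟩ := hx
  obtain ⟨f, hf, hfy⟩ := hy
  obtain rfl := he.unique hf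
  obtain ⟨m', -, rfl⟩ := he.2.2 m hm
  calc x = m' (m x) := hex.symm
    _ = m' (m y) := by rw [hxy]
    _ = y := hfy

end IsRecurrentFor

end CommutativeAction

open Set in
theorem isRecurrentFor_closure_of_surjOn {X : Type*} [Finite X] {S : Set (Function.End X)}
    [IsMulCommutative (Submonoid.closure S)] {T : Set X} (hT : ∀ m ∈ S, SurjOn m T T) {x : X}
    (hx : x ∈ T) : IsRecurrentFor (Submonoid.closure S) x := by
  have : Finite (Function.End X) := inferInstanceAs (Finite (X → X))
  have surjOn : ∀ m ∈ Submonoid.closure S, SurjOn m T T := fun m hm => by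
    induction hm using Submonoid.closure_induction with
    | mem m hm => exact hT m hm
    | one => exact surjOn_id T
    | mul m m' _ _ h h' => exact h.comp h'
  obtain ⟨e, he⟩ := exists_isMinimalIdempotent (Submonoid.closure S)
  obtain ⟨y, -, rfl⟩ := surjOn e he.1 hx
  exact ⟨e, he, congrFun he.2.1 y⟩

namespace AbelianProcessor

variable {I U Q : Type*} {B : U → Type*} (p : AbelianProcessor I B Q) [Fintype I]

theorem exists_trans_eq_of_mem_monoid {m : Function.End Q} (hm : m ∈ p.monoid) :
    ∃ x, p.trans x = m := by
  classical
  induction hm using Submonoid.closure_induction with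
  | mem _ hm =>
    obtain ⟨a, rfl⟩ := hm
    exact ⟨_, p.trans_single a⟩
  | one => exact ⟨0, p.trans_zero⟩
  | mul _ _ _ _ h h' =>
    obtain ⟨x, rfl⟩ := h
    obtain ⟨y, rfl⟩ := h'
    exact ⟨x + y, p.trans_add x y⟩

theorem exists_forall_ge_isRecurrentFor_trans {r : Q} (hr : IsRecurrentFor p.monoid r) :
    ∃ z, ∀ x ≥ z, ∀ q, IsRecurrentFor p.monoid (p.trans x q) := by
  obtain ⟨e, he, -⟩ := hr
  obtain ⟨z, rfl⟩ := p.exists_trans_eq_of_mem_monoid he.1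
  refine ⟨z, fun x hx q => ⟨_, he, ?_⟩⟩
  obtain ⟨y, rfl⟩ := exists_add_of_le hx
  rw [p.trans_add]
  exact congrFun he.2.1 _

end AbelianProcessor

namespace AbelianNetwork

variable {V : Type*} {G : Digraph V} {A Q : V → Type*} {N : AbelianNetwork G A Q}

/-! ### The least action principle -/

theorem exec_append (w w' : List (Letter A)) (s : TotalState A Q) :
    N.exec (w ++ w') s = N.exec w' (N.exec w s) :=
  List.foldl_append

theorem sub_count_le_exec [DecidableEq (Letter A)] (w : List (Letter A)) (s : TotalState A Q)
    (a : Letter A) : s.1 a - w.count a ≤ (N.exec w s).1 a := by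
  induction w generalizing s with
  | nil => simp [exec]
  | cons b w ih =>
    refine le_trans ?_ (ih (N.process b s))
    simp only [process, List.count_cons, beq_iff_eq, eq_comm (a := b)]
    split_ifs <;> push_cast <;> linarith [(N.message b s.2 a).cast_nonneg (α := ℤ)]

theorem isLegal_append {w w' : List (Letter A)} {s : TotalState A Q} :
    N.IsLegal (w ++ w') s ↔ N.IsLegal w s ∧ N.IsLegal w' (N.exec w s) := by
  induction w generalizing s with
  | nil => exact (and_iff_right trivial).symm
  | cons a w ih => exact (and_congr_right fun _ => ih).trans and_assoc.symm

theorem IsLegal.mono {w : List (Letter A)} {x y : Letter A → ℤ} {q : ∀ v, Q v}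
    (hw : N.IsLegal w (x, q)) (hxy : x ≤ y) : N.IsLegal w (y, q) := by
  induction w generalizing x y q with
  | nil => trivial
  | cons a w ih =>
    exact ⟨hw.1.trans (hxy a), ih hw.2 fun b => add_le_add_left (sub_le_sub_right (hxy b) _) _⟩

theorem IsLegal.exec_nonneg {w : List (Letter A)} {s : TotalState A Q} (hw : N.IsLegal w s)
    (hs : 0 ≤ s.1) : 0 ≤ (N.exec w s).1 := by
  classical
  induction w generalizing s with
  | nil => exact hs
  | cons a w ih =>
    refine ih hw.2 fun b => ?_
    have ha : 1 ≤ s.1 a := hw.1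
    have hb : 0 ≤ s.1 b := hs b
    simp only [process, Pi.zero_apply]
    split_ifs with hba
    · subst hba; linarith [(N.message b s.2 b).cast_nonneg (α := ℤ)]
    · linarith [(N.message a s.2 b).cast_nonneg (α := ℤ)]

theorem isLegal_of_count_le [DecidableEq (Letter A)] {w : List (Letter A)} {s : TotalState A Q}
    (hw : ∀ a, (w.count a : ℤ) ≤ s.1 a) : N.IsLegal w s := by
  induction w generalizing s with
  | nil => trivial
  | cons a w ih =>
    refine ⟨?_, ih fun b => ?_⟩
    · have := hw a
      rw [List.count_cons_self] at this
      push_cast at this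
      linarith [(w.count a).cast_nonneg (α := ℤ)]
    · have hcount := hw b
      have hexec : s.1 b - [a].count b ≤ (N.process a s).1 b := sub_count_le_exec [a] s b
      simp only [List.count_cons, List.count_nil] at hcount hexec
      push_cast at hcount hexec
      linarith

theorem IsComplete.mem_of_one_le {w : List (Letter A)} {s : TotalState A Q}
    (hw : N.IsComplete w s) {a : Letter A} (ha : 1 ≤ s.1 a) : a ∈ w := by
  classical
  have h : s.1 a - w.count a ≤ 0 := (sub_count_le_exec w s a).trans (hw a)
  exact List.count_pos_iff.1 (by omega)

theorem IsLegal.subperm {w w' : List (Letter A)} {s : TotalState A Q}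
    (hw : N.IsLegal w s) (hw' : N.IsComplete w' s) : w.Subperm w' := by
  classical
  induction w generalizing w' s with
  | nil => exact List.nil_subperm
  | cons a w ih =>
    have hperm := List.perm_cons_erase (hw'.mem_of_one_le hw.1)
    have hcomplete : N.IsComplete (w'.erase a) (N.process a s) := by
      rwa [IsComplete, N.exec_perm hperm] at hw'
    exact ((List.subperm_cons a).2 (ih hw.2 hcomplete)).trans hperm.symm.subperm

theorem IsLegal.exec_eq_of_isComplete {w w' : List (Letter A)} {s : TotalState A Q}
    (hw : N.IsLegal w s) (hc : N.IsComplete w s) (hw' : N.IsLegal w' s)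
    (hc' : N.IsComplete w' s) : N.exec w s = N.exec w' s :=
  N.exec_perm ((hw.subperm hc').antisymm (hw'.subperm hc)) s

/-! ### The global action -/

/-- The total state `x.q` with nonnegative numbers of waiting letters. -/
abbrev input (x : Letter A → ℕ) (q : ∀ v, Q v) : TotalState A Q := (fun a => (x a : ℤ), q)

theorem input_nonneg (x : Letter A → ℕ) (q : ∀ v, Q v) : 0 ≤ (input x q).1 :=
  fun a => Int.natCast_nonneg (x a)

/-- Some legal execution leads from `x.q` to `y.p`. -/
def Leads (N : AbelianNetwork G A Q) (x : Letter A → ℕ) (q : ∀ v, Q v) (y : Letter A → ℕ)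
    (p : ∀ v, Q v) : Prop :=
  ∃ w, N.IsLegal w (input x q) ∧ N.exec w (input x q) = input y p

theorem IsLegal.exec_eq_input {w : List (Letter A)} {x : Letter A → ℕ} {q : ∀ v, Q v}
    (hw : N.IsLegal w (input x q)) :
    N.exec w (input x q) =
      input (posVec (N.exec w (input x q)).1) (N.exec w (input x q)).2 :=
  Prod.ext (funext fun a => (Int.toNat_of_nonneg (hw.exec_nonneg (input_nonneg x q) a)).symm) rfl

theorem Leads.refl (x : Letter A → ℕ) (q : ∀ v, Q v) : N.Leads x q x q :=
  ⟨[], trivial, rfl⟩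

theorem Leads.trans {x y z : Letter A → ℕ} {q p s : ∀ v, Q v} (h : N.Leads x q y p)
    (h' : N.Leads y p z s) : N.Leads x q z s := by
  obtain ⟨w, hw, he⟩ := h
  obtain ⟨w', hw', he'⟩ := h'
  exact ⟨w ++ w', isLegal_append.2 ⟨hw, he ▸ hw'⟩, by rw [exec_append, he, he']⟩

theorem Leads.add_right {x y : Letter A → ℕ} {q p : ∀ v, Q v} (h : N.Leads x q y p)
    (z : Letter A → ℕ) : N.Leads (x + z) q (y + z) p := by
  obtain ⟨w, hw, he⟩ := h
  have input_add (u : Letter A → ℕ) (s : ∀ v, Q v) :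
      input (u + z) s = ((input u s).1 + fun a => (z a : ℤ), s) :=
    Prod.ext (funext fun a => Nat.cast_add (u a) (z a)) rfl
  refine ⟨w, hw.mono fun a => by simp, ?_⟩
  rw [input_add, N.exec_shift w (input x q), he, input_add]

section GlobalAction

variable (h : N.HaltsOnAllInputs)

theorem leads_globalAct (x : Letter A → ℕ) (q : ∀ v, Q v) :
    N.Leads x q 0 (N.globalAct h x q) := by
  obtain ⟨hlegal, hcomplete⟩ := (h x q).choose_spec
  exact ⟨_, hlegal, Prod.ext (le_antisymm hcomplete (hlegal.exec_nonneg (input_nonneg x q))) rfl⟩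

theorem Leads.globalAct_eq_of_zero {x : Letter A → ℕ} {q p : ∀ v, Q v} (hl : N.Leads x q 0 p) :
    N.globalAct h x q = p := by
  obtain ⟨w, hw, he⟩ := hl
  obtain ⟨w', hw', he'⟩ := leads_globalAct h x q
  have := hw'.exec_eq_of_isComplete (congrArg Prod.fst he').le hw (congrArg Prod.fst he).le
  exact congrArg Prod.snd (he'.symm.trans (this.trans he))

theorem Leads.globalAct_eq {x y : Letter A → ℕ} {q p : ∀ v, Q v} (hl : N.Leads x q y p) :
    N.globalAct h x q = N.globalAct h y p :=
  (hl.trans (leads_globalAct h y p)).globalAct_eq_of_zero h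

theorem globalAct_add (x y : Letter A → ℕ) (q : ∀ v, Q v) :
    N.globalAct h (x + y) q = N.globalAct h x (N.globalAct h y q) := by
  have hl := ((leads_globalAct h y q).add_right x).globalAct_eq h
  rwa [zero_add, add_comm] at hl

theorem globalAct_mem_range_of_mem {x : Letter A → ℕ} {q : ∀ v, Q v} {w : List (Letter A)}
    (hw : N.IsLegal w (input x q)) {a : Letter A} (ha : a ∈ w) [DecidableEq (Letter A)] :
    N.globalAct h x q ∈ Set.range (N.globalAct h (Pi.single a 1)) := by
  obtain ⟨w₁, w₂, rfl⟩ := List.append_of_mem ha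
  obtain ⟨hw₁, hcons⟩ := isLegal_append.1 hw
  have hl : N.Leads x q _ _ := ⟨w₁, hw₁, hw₁.exec_eq_input⟩
  set y := posVec (N.exec w₁ (input x q)).1
  have hay : Pi.single a 1 ≤ y := by
    have ha : 1 ≤ y a := Int.lt_toNat.2 (Int.lt_of_add_one_le hcons.1)
    intro b
    rcases eq_or_ne b a with rfl | hba
    · rwa [Pi.single_eq_same]
    · rw [Pi.single_eq_of_ne hba]
      exact Nat.zero_le _
  obtain ⟨z, hz⟩ := exists_add_of_le hay
  rw [hl.globalAct_eq h, hz, globalAct_add]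
  exact Set.mem_range_self _

/-- The map `q ↦ x ▷▷ q` as an element of the monoid of self-maps of the state space. -/
noncomputable def globalMap (x : Letter A → ℕ) : Function.End (∀ v, Q v) := N.globalAct h x

theorem globalMap_zero : globalMap h 0 = 1 :=
  funext fun q => (Leads.refl 0 q).globalAct_eq_of_zero h

theorem globalMap_add (x y : Letter A → ℕ) :
    globalMap h (x + y) = globalMap h x * globalMap h y :=
  funext (globalAct_add h x y)

theorem globalMap_nsmul (n : ℕ) (x : Letter A → ℕ) :
    globalMap h (n • x) = globalMap h x ^ n := by
  induction n with
  | zero => rw [zero_smul, pow_zero, globalMap_zero]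
  | succ n ih => rw [succ_nsmul, pow_succ, ← ih, globalMap_add]

theorem globalMap_comm (x y : Letter A → ℕ) :
    globalMap h x * globalMap h y = globalMap h y * globalMap h x := by
  rw [← globalMap_add, add_comm, globalMap_add]

theorem globalMonoid_eq_closure [DecidableEq (Letter A)] :
    N.globalMonoid h =
      Submonoid.closure (Set.range fun a => globalMap h (Pi.single a 1)) := by
  refine congrArg (fun f => Submonoid.closure (Set.range f)) (funext fun a => ?_)
  change N.globalAct h _ = N.globalAct h _
  congr!

instance : IsMulCommutative (N.globalMonoid h) := by
  classical
  rw [globalMonoid_eq_closure]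
  refine Submonoid.isMulCommutative_closure _ ?_
  rintro _ ⟨a, rfl⟩ _ ⟨b, rfl⟩
  exact globalMap_comm h _ _

theorem globalMap_mem_globalMonoid [Finite (Letter A)] (x : Letter A → ℕ) :
    globalMap h x ∈ N.globalMonoid h := by
  classical
  rw [globalMonoid_eq_closure]
  induction x using Pi.single_induction with
  | zero => exact globalMap_zero h ▸ one_mem _
  | add x y hx hy => exact globalMap_add h x y ▸ mul_mem hx hy
  | single a n =>
    have : Pi.single a n = n • (Pi.single a 1 : Letter A → ℕ) := by
      rw [← Pi.single_smul, smul_eq_mul, mul_one]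
    rw [this, globalMap_nsmul]
    exact pow_mem (Submonoid.subset_closure (Set.mem_range_self a)) n

end GlobalAction

/-! ### Production and toppling -/

section LocalAction

variable [Fintype V] [∀ v, Fintype (A v)]

/-- The state reached from `q` when `u` is processed: the state `p` with `u ▷ q = y.p`. -/
noncomputable def localState (N : AbelianNetwork G A Q) (u : Letter A → ℕ) (q : ∀ v, Q v) :
    ∀ v, Q v :=
  (N.localAct u (0, q)).2

theorem localState_apply (u : Letter A → ℕ) (q : ∀ v, Q v) (v : V) :
    N.localState u q v = (N.proc v).trans (fun a => u ⟨v, a⟩) (q v) :=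
  N.localAct_snd u (0, q) v

theorem localState_zero (q : ∀ v, Q v) : N.localState 0 q = q := by
  funext v
  rw [localState_apply]
  exact congrFun (N.proc v).trans_zero (q v)

theorem localState_add (u u' : Letter A → ℕ) (q : ∀ v, Q v) :
    N.localState (u + u') q = N.localState u' (N.localState u q) := by
  funext v
  simp only [localState, localAct_add, localAct_snd]

theorem localState_comm (u u' : Letter A → ℕ) (q : ∀ v, Q v) :
    N.localState u (N.localState u' q) = N.localState u' (N.localState u q) := by
  rw [← localState_add, add_comm, localState_add]

theorem sent_add_localState (u u' : Letter A → ℕ) (q : ∀ v, Q v) :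
    N.sent (u + u') q = N.sent u q + N.sent u' (N.localState u q) :=
  N.sent_add u u' q

theorem exec_wordOf (u : Letter A → ℕ) (q : ∀ v, Q v) :
    N.exec (wordOf u) (input u q) = (N.sent u q, N.localState u q) := by
  have : input u q = (fun a => (u a : ℤ) + (0 : Letter A → ℤ) a, q) := by simp
  rw [this]
  rfl

theorem isLegal_wordOf (u : Letter A → ℕ) (q : ∀ v, Q v) :
    N.IsLegal (wordOf u) (input u q) := by
  classical
  exact isLegal_of_count_le fun a => by rw [wordOf_count]

theorem sent_nonneg (u : Letter A → ℕ) (q : ∀ v, Q v) : 0 ≤ N.sent u q := by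
  have := (isLegal_wordOf (N := N) u q).exec_nonneg (input_nonneg u q)
  rwa [exec_wordOf] at this

theorem leads_localState (u : Letter A → ℕ) (q : ∀ v, Q v) :
    N.Leads u q (posVec (N.sent u q)) (N.localState u q) := by
  have := (isLegal_wordOf (N := N) u q).exec_eq_input
  rw [exec_wordOf] at this
  exact ⟨_, isLegal_wordOf u q, (exec_wordOf u q).trans this⟩

theorem exec_eq [DecidableEq (Letter A)] (w : List (Letter A)) (s : TotalState A Q) :
    N.exec w s = (s.1 - (fun a => (w.count a : ℤ)) + N.sent (w.count ·) s.2,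
      N.localState (w.count ·) s.2) := by
  have hperm : w.Perm (wordOf (w.count ·)) := List.perm_iff_count.2 fun a => by rw [wordOf_count]
  have hshift := N.exec_shift (wordOf (w.count ·)) (input (w.count ·) s.2)
    (s.1 - fun a => (w.count a : ℤ))
  rw [exec_wordOf, add_sub_cancel, ← N.exec_perm hperm] at hshift
  rw [hshift, add_comm]

variable {c u k : Letter A → ℕ} {p q s : ∀ v, Q v}

theorem localState_nsmul (hs : N.localState c s = s) (n : ℕ) : N.localState (n • c) s = s := by
  induction n with
  | zero => rw [zero_smul, localState_zero]
  | succ n ih => rw [succ_nsmul, localState_add, ih, hs]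

theorem sent_nsmul (hs : N.localState c s = s) (n : ℕ) : N.sent (n • c) s = n • N.sent c s := by
  induction n with
  | zero =>
    have := sent_add_localState (N := N) 0 0 s
    rw [add_zero, localState_zero, left_eq_add] at this
    rw [zero_smul, zero_smul, this]
  | succ n ih => rw [succ_nsmul, sent_add_localState, localState_nsmul hs, ih, succ_nsmul]

theorem sent_localState (hs : N.localState c s = s) (u : Letter A → ℕ) :
    N.sent c (N.localState u s) = N.sent c s := by
  have := sent_add_localState (N := N) c u s
  rw [add_comm, sent_add_localState, hs, add_comm] at this
  exact add_right_cancel this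

theorem nsmul_sent_add_sent_sub (hk : N.localState k s = s) (hu : N.localState u s = s) (n : ℕ) :
    n • N.sent k s + N.sent (n • (u - k)) s = n • N.sent u s + N.sent (n • (k - u)) s := by
  have hswap : n • k + n • (u - k) = n • u + n • (k - u) := by
    rw [← smul_add, ← smul_add]
    exact congrArg _ (funext fun a => by simp only [Pi.add_apply, Pi.sub_apply]; omega)
  simpa only [sent_add_localState, localState_nsmul hk, localState_nsmul hu, sent_nsmul hk,
    sent_nsmul hu] using congrArg (N.sent · s) hswap

theorem IsIrreducible.exists_localState_eq (hirr : N.IsIrreducible) (p q : ∀ v, Q v) :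
    ∃ x y, N.localState x p = N.localState y q := by
  choose m hm m' hm' h using fun v => hirr v (p v) (q v)
  choose x hx using fun v => (N.proc v).exists_trans_eq_of_mem_monoid (hm v)
  choose y hy using fun v => (N.proc v).exists_trans_eq_of_mem_monoid (hm' v)
  refine ⟨fun a => x a.1 a.2, fun a => y a.1 a.2, funext fun v => ?_⟩
  rw [localState_apply, localState_apply, hx, hy, h]

theorem IsIrreducible.sent_eq (hirr : N.IsIrreducible) (hp : N.localState c p = p)
    (hq : N.localState c q = q) : N.sent c p = N.sent c q := by
  obtain ⟨x, y, h⟩ := hirr.exists_localState_eq p q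
  rw [← sent_localState hp x, h, sent_localState hq]

theorem HaltsOnAllInputs.eq_zero_of_le_sent (h : N.HaltsOnAllInputs) (hs : N.localState c s = s)
    (hc : ∀ a, (c a : ℤ) ≤ N.sent c s a) : c = 0 := by
  classical
  have hcd : c ≤ posVec (N.sent c s) := fun a => (Int.le_toNat (sent_nonneg c s a)).2 (hc a)
  obtain ⟨w, hw, hcw⟩ := h c s
  obtain ⟨w', hw', hcw'⟩ := h (posVec (N.sent c s)) s
  have hlegal : N.IsLegal (wordOf c ++ w') (input c s) := by
    refine isLegal_append.2 ⟨isLegal_wordOf c s, ?_⟩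
    rwa [(isLegal_wordOf c s).exec_eq_input, exec_wordOf, hs]
  have hle : (wordOf c ++ w').length ≤ w'.length :=
    (hlegal.subperm hcw).length_le.trans
      ((hw.mono fun a => Int.ofNat_le.2 (hcd a)).subperm hcw').length_le
  have hnil : wordOf c = [] := by
    rw [List.length_append] at hle
    exact List.eq_nil_of_length_eq_zero (by omega)
  funext a
  rw [← wordOf_count c a, hnil, List.count_nil, Pi.zero_apply]

theorem exists_localState_nsmul_fixed [∀ v, Finite (Q v)] (c : Letter A → ℕ) (q : ∀ v, Q v) :
    ∃ i n : ℕ, 0 < n ∧ N.localState (n • c) (N.localState (i • c) q) = N.localState (i • c) q := by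
  obtain ⟨i, j, hij, h⟩ :=
    Set.finite_univ.exists_lt_map_eq_of_forall_mem
      (f := fun n : ℕ => N.localState (n • c) q) fun _ => Set.mem_univ _
  refine ⟨i, j - i, Nat.sub_pos_of_lt hij, ?_⟩
  rw [← localState_add, ← add_smul, Nat.add_sub_cancel' hij.le]
  exact h.symm

theorem HaltsOnAllInputs.le_of_sub_sent_le_of_fixed [∀ v, Finite (Q v)] (h : N.HaltsOnAllInputs)
    (hk : N.localState k s = s) (hu : N.localState u s = s)
    (hle : ∀ a, k a - N.sent k s a ≤ u a - N.sent u s a) : k ≤ u := by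
  obtain ⟨i, n, hn, hc⟩ := exists_localState_nsmul_fixed (N := N) (k - u) s
  have hkfix := (localState_comm k (i • (k - u)) s).trans (congrArg _ hk)
  have hufix := (localState_comm u (i • (k - u)) s).trans (congrArg _ hu)
  rw [← sent_localState hk (i • (k - u)), ← sent_localState hu (i • (k - u))] at hle
  generalize N.localState (i • (k - u)) s = p at hle hc hkfix hufix
  have hswap := nsmul_sent_add_sent_sub hkfix hufix n
  have hzero : n • (k - u) = 0 := by
    refine h.eq_zero_of_le_sent hc fun a => ?_
    have hnonneg := sent_nonneg (N := N) (n • (u - k)) p a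
    have hnonneg' := sent_nonneg (N := N) (n • (k - u)) p a
    have hswapa := congrFun hswap a
    simp only [Pi.add_apply, Pi.smul_apply, Pi.sub_apply, Pi.zero_apply, smul_eq_mul,
      nsmul_eq_mul (α := ℤ)] at hnonneg hnonneg' hswapa ⊢
    rcases le_total (k a) (u a) with hku | huk
    · rwa [Nat.sub_eq_zero_of_le hku, mul_zero, Nat.cast_zero]
    · rw [Nat.cast_mul, Nat.cast_sub huk]
      linarith [mul_le_mul_of_nonneg_left (hle a) (n.cast_nonneg (α := ℤ))]
  intro a
  exact Nat.sub_eq_zero_iff_le.1 ((smul_eq_zero.1 (congrFun hzero a)).resolve_left hn.ne')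

theorem HaltsOnAllInputs.le_of_sub_sent_le [∀ v, Finite (Q v)] (h : N.HaltsOnAllInputs)
    (hirr : N.IsIrreducible) (hk : N.localState k p = p) (hu : N.localState u q = q)
    (hle : ∀ a, k a - N.sent k p a ≤ u a - N.sent u q a) : k ≤ u := by
  obtain ⟨x, y, hxy⟩ := hirr.exists_localState_eq p q
  have hk' : N.localState k (N.localState x p) = N.localState x p := by rw [localState_comm, hk]
  have hu' : N.localState u (N.localState x p) = N.localState x p := by
    rw [hxy, localState_comm, hu]
  refine h.le_of_sub_sent_le_of_fixed hk' hu' ?_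
  rwa [sent_localState hk, hxy, sent_localState hu]

end LocalAction

/-! ### Recurrent states -/

section Recurrence

variable {h : N.HaltsOnAllInputs} {p q r : ∀ v, Q v} {x y k : Letter A → ℕ}

theorem IsRecurrent.isLocallyRecurrent [Finite V] [∀ v, Finite (A v)] (hq : N.IsRecurrent h q)
    (hr : N.IsLocallyRecurrent r) : N.IsLocallyRecurrent q := by
  classical
  have := Fintype.ofFinite V
  have := fun v => Fintype.ofFinite (A v)
  choose z hz using fun v => (N.proc v).exists_forall_ge_isRecurrentFor_trans (hr v)
  obtain ⟨q', hq'⟩ := hq.exists_apply_eq (globalMap_mem_globalMonoid h fun a => z a.1 a.2)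
  obtain ⟨w, -, hw⟩ := leads_globalAct h (fun a => z a.1 a.2) q'
  have hstate : N.localState (w.count ·) q' = q :=
    (congrArg Prod.snd ((exec_eq w _).symm.trans hw)).trans hq'
  intro v
  rw [← hstate, localState_apply]
  refine hz v _ (fun a => ?_) _
  have hcount := (sub_count_le_exec w _ ⟨v, a⟩).trans_eq (congrFun (congrArg Prod.fst hw) ⟨v, a⟩)
  exact Int.ofNat_le.1 (sub_nonpos.1 hcount)

theorem IsRecurrent.globalAct_eq_self [Finite (Letter A)] (hq : N.IsRecurrent h q)
    (hl : N.Leads (y + x) q y q) : N.globalAct h x q = q := by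
  refine (hq.apply (globalMap_mem_globalMonoid h x)).eq_of_apply_eq hq
    (globalMap_mem_globalMonoid h y) ?_
  exact (globalAct_add h y x q).symm.trans (hl.globalAct_eq h)

variable [Fintype V] [∀ v, Fintype (A v)]

theorem mem_range_globalAct_single [∀ v, Finite (Q v)] [DecidableEq (Letter A)]
    (hirr : N.IsIrreducible) (hk : ∀ a, 0 < k a) (hkp : N.localState k p = p)
    (hx : posVec (N.sent k p) + x = k) {n : ℕ} (hn : 0 < n) (hq : N.globalAct h (n • x) q = q)
    (a : Letter A) : q ∈ Set.range (N.globalAct h (Pi.single a 1)) := by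
  obtain ⟨w, hw, he⟩ := leads_globalAct h (n • x) q
  rw [hq, exec_eq, Prod.mk.injEq] at he
  have hkw : k ≤ fun a => w.count a := by
    refine h.le_of_sub_sent_le (q := q) hirr hkp he.2 fun a => ?_
    have hcount : (n * x a : ℕ) - (w.count a : ℤ) + N.sent (w.count ·) q a = 0 := congrFun he.1 a
    have hxn : x a ≤ n * x a := Nat.le_mul_of_pos_left (x a) hn
    have hxa : (N.sent k p a).toNat + x a = k a := congrFun hx a
    have hnonneg : 0 ≤ N.sent k p a := sent_nonneg k p a
    omega
  have ha : a ∈ w := List.count_pos_iff.1 ((hk a).trans_le (hkw a))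
  simpa only [hq] using globalAct_mem_range_of_mem h hw ha

theorem isRecurrent_of_globalAct_eq_self [∀ v, Finite (Q v)] (hirr : N.IsIrreducible)
    (hk : ∀ a, 0 < k a) (hkp : N.localState k p = p) (hx : posVec (N.sent k p) + x = k)
    (hq : N.globalAct h x q = q) : N.IsRecurrent h q := by
  classical
  have : Finite (Function.End (∀ v, Q v)) := inferInstanceAs (Finite ((∀ v, Q v) → ∀ v, Q v))
  obtain ⟨n, hn, hidem⟩ := exists_isIdempotentElem_pow (globalMap h x)
  rw [← globalMap_nsmul] at hidem
  have hfix : globalMap h (n • x) q = q := by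
    rw [globalMap_nsmul]
    exact Function.iterate_fixed hq n
  have : IsMulCommutative (Submonoid.closure (Set.range fun a => globalMap h (Pi.single a 1))) := by
    rw [← globalMonoid_eq_closure]
    infer_instance
  rw [IsRecurrent, globalMonoid_eq_closure]
  refine isRecurrentFor_closure_of_surjOn (T := {s | globalMap h (n • x) s = s}) ?_ hfix
  rintro _ ⟨a, rfl⟩ s hs
  obtain ⟨s', rfl⟩ := mem_range_globalAct_single hirr hk hkp hx hn hs a
  refine ⟨globalMap h (n • x) s', congrFun hidem s', ?_⟩
  exact (congrFun (globalMap_comm h (Pi.single a 1) (n • x)) s').trans hs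

end Recurrence

end AbelianNetwork

theorem theorem5p4 {V : Type*} [Fintype V] {G : Digraph V} {A Q : V → Type*}
    [∀ v, Fintype (A v)] [∀ v, Finite (Q v)] (N : AbelianNetwork G A Q)
    (hirr : N.IsIrreducible) (hhalt : N.HaltsOnAllInputs)
    (r : ∀ v, Q v) (hr : N.IsLocallyRecurrent r)
    (k : N.totalKernel) (hk : 1 ≤ (k : Letter A → ℤ))
    (hPk : N.production r hr k ≤ (k : Letter A → ℤ)) (q : ∀ v, Q v) :
    N.IsRecurrent hhalt q ↔
      N.globalAct hhalt (posVec ((k : Letter A → ℤ) - N.production r hr k)) q = q := by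
  have hk0 : 0 ≤ k.1 := zero_le_one.trans hk
  have hfix {s} (hs : N.IsLocallyRecurrent s) : N.localState (posVec k.1) s = s :=
    congrArg Prod.snd (N.localAct_eq_production s hs k hk0)
  have hsent : N.sent (posVec k.1) r = N.production r hr k :=
    congrArg Prod.fst (N.localAct_eq_production r hr k hk0)
  rw [← hsent] at hPk ⊢
  have hx := posVec_add_posVec_sub (AbelianNetwork.sent_nonneg (posVec k.1) r) hPk
  constructor
  · intro hq
    have hqfix := hfix (hq.isLocallyRecurrent hr)
    have hl := AbelianNetwork.leads_localState (N := N) (posVec k.1) q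
    rw [hqfix, hirr.sent_eq hqfix (hfix hr)] at hl
    refine hq.globalAct_eq_self (y := posVec (N.sent (posVec k.1) r)) ?_
    rwa [hx]
  · have hpos (a : Letter A) : 0 < posVec k.1 a := Int.lt_toNat.2 (Int.lt_of_add_one_le (hk a))
    exact AbelianNetwork.isRecurrent_of_globalAct_eq_self hirr hpos (hfix hr) hx
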